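/- All graphs are finite and simple. An odd-cycle graph is a graph without even cycles. For a graph $G$ of order $n$ let $m_k(G)$ be the number of sets of $k$ pairwise vertex-disjoint edges of $G$, let $m(G,x)=\sum_{k=0}^{\lfloor n/2\rfloor}(-1)^k m_k(G)\,x^{n-2k}$ be its matching polynomial, and let $t(G)$ be the largest real root of $m(G,x)$. For integers $n\ge 1$ and $m\ge 0$ let $F(n,m)$ denote an odd-cycle graph of order $n$ with exactly $m$ edges and with a vertex of degree $n-1$. Theorem. (0) For $n\ge 1$ and $n-1\le m\le\lfloor 3(n-1)/2\rfloor$ a graph $F(n,m)$ exists, and for every graph $F(n,m)$ the polynomial $m(F(n,m),x)$ has a largest real root $t(F(n,m))$. (1) Let $n\ge 1$ and $n-1\le m\le \lfloor 3(n-1)/2\rfloor-1$. Then, for all graphs $F(n,m)$ and $F(n,m+1)$, $$t(F(n,m))<t(F(n,m+1)).$$ (2) Let $m\ge 4$ and $\lceil (2m+1)/3\rceil\le n\le m$. Then, for all graphs $F(n,m)$ and $F(n+1,m)$, $$t(F(n,m))<t(F(n+1,m)).$$ -/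

import Mathlib

open Polynomial

namespace OddCycleGraphs

/-- An odd-cycle graph: a simple graph without even cycles. -/
def IsOddCycleGraph {V : Type*} (G : SimpleGraph V) : Prop :=
  ∀ (v : V) (c : G.Walk v v), c.IsCycle → ¬ Even c.length

/-- The number `m_r(G)` of sets of `r` independent (pairwise vertex-disjoint) edges of `G`. -/
noncomputable def numMatchings {V : Type*} (G : SimpleGraph V) (r : ℕ) : ℕ :=
  Set.ncard {M : Finset (Sym2 V) |
    (M : Set (Sym2 V)) ⊆ G.edgeSet ∧ M.card = r ∧
      (M : Set (Sym2 V)).Pairwise fun e f => ∀ v, v ∈ e → v ∉ f}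

/-- The matching polynomial `m(G,x) = ∑ₖ (-1)ᵏ mₖ(G) x^(n-2k)`, where `n` is the order of `G`.
The sum stops at `k = ⌊n/2⌋`, because `r` independent edges cover `2r ≤ n` vertices. -/
noncomputable def matchingPoly {V : Type*} [Fintype V] (G : SimpleGraph V) : ℝ[X] :=
  ∑ k ∈ Finset.range (Fintype.card V / 2 + 1),
    C ((-1 : ℝ) ^ k * (numMatchings G k : ℝ)) * X ^ (Fintype.card V - 2 * k)

/-- The set of (real) matching roots of `G`. -/
def matchingRoots {V : Type*} [Fintype V] (G : SimpleGraph V) : Set ℝ :=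
  {x : ℝ | (matchingPoly G).eval x = 0}

/-- The maximum matching root `t(G)`. -/
noncomputable def maxMatchingRoot {V : Type*} [Fintype V] (G : SimpleGraph V) : ℝ :=
  sSup (matchingRoots G)

/-- `IsF G n m`: the graph `G` is (a copy of) `F(n,m)`, that is, an odd-cycle graph of order `n`
and size `m` with a vertex of degree `n - 1`. -/
structure IsF {V : Type*} [Fintype V] (G : SimpleGraph V) (n m : ℕ) : Prop where
  order : Fintype.card V = n
  size : G.edgeSet.ncard = m
  oddCycle : IsOddCycleGraph G
  exists_degree : ∃ v : V, (G.neighborSet v).ncard = n - 1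

end OddCycleGraphs

open OddCycleGraphs

open OddCycleGraphs

namespace OddCycleGraphs

/-! Let `v` be the vertex of degree n - 1. Two edges avoiding `v` cannot share a vertex, since they
would close a 4-cycle through `v`. So F(n,m) is k = m - n + 1 triangles and p = 3n - 3 - 2m pendant
edges glued at `v`. Sorting matchings by their edge at `v` gives, with z = -1/x², the generating
function (1+z)^k + pz(1+z)^k + 2kz(1+z)^(k-1). For k ≥ 1 this is (1+z)^(k-1) (1 + nz + pz²), so the
roots other than 0 and ±1 satisfy q(x²) = 0, where q(y) = y² - ny + p. Hence t² is the larger root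
of q, which also holds for stars with n ≥ 2 (`IsF.isGreatest_sqrt`). Both inequalities follow by
evaluating the new quadratic at the old root y, where it must be negative (`lt_largerRoot`). Its
value is -2 when m grows by one, and 3 - y when n does. Since q(3) = 6 - 2m < 0 for m ≥ 4, y > 3. -/

open Classical in
/-- The finset of all matchings of a finite graph. -/
noncomputable def matchings {V : Type*} [Fintype V] (G : SimpleGraph V) :
    Finset (Finset (Sym2 V)) :=
  Finset.univ.filter fun M => (M : Set (Sym2 V)) ⊆ G.edgeSet ∧
    (M : Set (Sym2 V)).Pairwise fun e f => ∀ v, v ∈ e → v ∉ f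

open Classical in
/-- The edges of a graph that avoid a given vertex. -/
noncomputable def edgesAvoiding {V : Type*} [Fintype V] (G : SimpleGraph V) (v : V) :
    Finset (Sym2 V) :=
  Finset.univ.filter fun e => e ∈ G.edgeSet ∧ v ∉ e

/-! ### Matchings of a graph with a dominating vertex. -/

section Counting

variable {V : Type*} [Fintype V] {G : SimpleGraph V}

theorem mem_matchings {M : Finset (Sym2 V)} :
    M ∈ matchings G ↔ (M : Set (Sym2 V)) ⊆ G.edgeSet ∧
      (M : Set (Sym2 V)).Pairwise fun e f => ∀ v, v ∈ e → v ∉ f := by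
  simp [matchings]

theorem mem_edgesAvoiding {v : V} {e : Sym2 V} :
    e ∈ edgesAvoiding G v ↔ e ∈ G.edgeSet ∧ v ∉ e := by
  simp [edgesAvoiding]

theorem numMatchings_eq_card (r : ℕ) :
    numMatchings G r = ((matchings G).filter fun M => M.card = r).card := by
  classical
  rw [numMatchings, ← Set.ncard_coe_finset]
  congr 1
  ext M
  simp only [Finset.coe_filter, Set.mem_ofPred_eq, mem_matchings]
  tauto

/-- Ensures that the exponent n - 2k never truncates and that the range in `matchingPoly` omits no
matching. -/
theorem two_mul_card_le_of_mem_matchings {M : Finset (Sym2 V)} (hM : M ∈ matchings G) :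
    2 * M.card ≤ Fintype.card V := by
  classical
  obtain ⟨hE, hd⟩ := mem_matchings.1 hM
  have h : (M.biUnion Sym2.toFinset).card = ∑ e ∈ M, e.toFinset.card := by
    refine Finset.card_biUnion fun e he f hf hef => ?_
    refine Finset.disjoint_left.2 fun a ha ha' => ?_
    exact hd he hf hef a (Sym2.mem_toFinset.1 ha) (Sym2.mem_toFinset.1 ha')
  have h2 : ∑ e ∈ M, e.toFinset.card = ∑ _e ∈ M, 2 :=
    Finset.sum_congr rfl fun e he =>
      Sym2.card_toFinset_of_not_isDiag e (G.not_isDiag_of_mem_edgeSet (hE he))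
  rw [Finset.sum_const, smul_eq_mul] at h2
  have := Finset.card_le_univ (M.biUnion Sym2.toFinset)
  omega

theorem eval_matchingPoly (x : ℝ) :
    (matchingPoly G).eval x =
      ∑ M ∈ matchings G, (-1) ^ M.card * x ^ (Fintype.card V - 2 * M.card) := by
  rw [matchingPoly, eval_finsetSum, ← Finset.sum_fiberwise_of_maps_to
    (g := Finset.card) (t := Finset.range (Fintype.card V / 2 + 1))]
  · refine Finset.sum_congr rfl fun r _ => ?_
    rw [numMatchings_eq_card]
    rw [Finset.sum_congr rfl (g := fun _ => (-1 : ℝ) ^ r * x ^ (Fintype.card V - 2 * r))]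
    · simp only [eval_mul, eval_C, eval_pow, eval_X, Finset.sum_const, nsmul_eq_mul]
      ring
    · intro M hM
      rw [(Finset.mem_filter.1 hM).2]
  · intro M hM
    have := two_mul_card_le_of_mem_matchings hM
    rw [Finset.mem_range]
    omega

/-- Makes each matching's weight a power of one quantity z = -1/x², so that sums over free choices
of edges become powers of 1 + z. -/
theorem eval_matchingPoly_of_ne_zero {x : ℝ} (hx : x ≠ 0) :
    (matchingPoly G).eval x =
      x ^ Fintype.card V * ∑ M ∈ matchings G, (-1 / x ^ 2) ^ M.card := by
  rw [eval_matchingPoly, Finset.mul_sum]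
  refine Finset.sum_congr rfl fun M hM => ?_
  obtain ⟨j, hj⟩ := Nat.exists_eq_add_of_le (two_mul_card_le_of_mem_matchings hM)
  rw [hj, Nat.add_sub_cancel_left, pow_add, pow_mul, div_pow]
  field_simp

theorem sum_powerset_pow_card {α R : Type*} [CommSemiring R] (s : Finset α) (z : R) :
    ∑ t ∈ s.powerset, z ^ t.card = (1 + z) ^ s.card := by
  have := Finset.sum_pow_mul_eq_add_pow z 1 s
  simpa [add_comm] using this

open Classical in
/-- Splitting the matchings of a graph with a dominating vertex `v`, such that the edges avoiding
`v` are independent, according to the edge that covers `v`. -/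
theorem sum_matchings_pow_card {R : Type*} [CommRing R] {v : V} (hv : ∀ u, u ≠ v → G.Adj v u)
    (hd : ((edgesAvoiding G v : Finset (Sym2 V)) : Set (Sym2 V)).Pairwise
      fun e f => ∀ u, u ∈ e → u ∉ f) (z : R) :
    ∑ M ∈ matchings G, z ^ M.card = (1 + z) ^ (edgesAvoiding G v).card +
      ∑ u ∈ Finset.univ.erase v,
        z * (1 + z) ^ ((edgesAvoiding G v).filter fun e => u ∉ e).card := by
  rw [← Finset.sum_filter_add_sum_filter_not (matchings G) (fun M => ∀ e ∈ M, v ∉ e)]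
  congr 1
  -- Matchings missing `v` are exactly the subsets of `edgesAvoiding G v`, as these edges are
  -- independent.
  · rw [← sum_powerset_pow_card]
    refine Finset.sum_congr ?_ fun _ _ => rfl
    ext M
    simp only [Finset.mem_filter, mem_matchings, Finset.mem_powerset]
    constructor
    · rintro ⟨⟨h1, -⟩, h2⟩ e he
      exact mem_edgesAvoiding.2 ⟨h1 he, h2 e he⟩
    · intro h
      exact ⟨⟨fun e he => (mem_edgesAvoiding.1 (h he)).1, hd.mono (by exact_mod_cast h)⟩,
        fun e he => (mem_edgesAvoiding.1 (h he)).2⟩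
  -- The other matchings correspond to pairs of a partner `u` of `v` and a set of edges avoiding
  -- both `u` and `v`.
  · simp only [← sum_powerset_pow_card, Finset.mul_sum]
    rw [Finset.sum_sigma']
    have hav : ∀ {u : V} {N : Finset (Sym2 V)},
        N ⊆ (edgesAvoiding G v).filter (fun e => u ∉ e) → ∀ e ∈ N, e ∈ G.edgeSet ∧ v ∉ e ∧ u ∉ e :=
      fun h e he => by
        have := Finset.mem_filter.1 (h he)
        exact ⟨(mem_edgesAvoiding.1 this.1).1, (mem_edgesAvoiding.1 this.1).2, this.2⟩
    symm
    refine Finset.sum_bij (fun (a : (_ : V) × Finset (Sym2 V)) _ => insert s(v, a.1) a.2)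
      ?_ ?_ ?_ ?_
    · rintro ⟨u, N⟩ h
      simp only [Finset.mem_sigma, Finset.mem_erase, Finset.mem_univ, and_true,
        Finset.mem_powerset] at h
      obtain ⟨hu, hN⟩ := h
      have hN' := hav hN
      simp only [Finset.mem_filter, mem_matchings, Finset.coe_insert]
      refine ⟨⟨?_, ?_⟩, ?_⟩
      · rintro e (rfl | he)
        · exact hv u hu
        · exact (hN' e he).1
      · rw [Set.pairwise_insert]
        refine ⟨hd.mono fun e he => (Finset.mem_filter.1 (hN he)).1, fun e he _ => ?_⟩
        obtain ⟨-, h1, h2⟩ := hN' e he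
        constructor
        · intro a ha
          rcases Sym2.mem_iff.1 ha with rfl | rfl <;> assumption
        · intro a ha ha'
          rcases Sym2.mem_iff.1 ha' with rfl | rfl <;> contradiction
      · intro h
        exact h _ (Finset.mem_insert_self _ _) (Sym2.mem_mk_left _ _)
    · rintro ⟨u, N⟩ h ⟨u', N'⟩ h' heq
      simp only [Finset.mem_sigma, Finset.mem_erase, Finset.mem_univ, and_true,
        Finset.mem_powerset] at h h' heq
      have hN := hav h.2
      have hN' := hav h'.2
      have h1 : s(v, u) ∈ insert s(v, u') N' := heq ▸ Finset.mem_insert_self _ _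
      have huu : u = u' := by
        rcases Finset.mem_insert.1 h1 with h1 | h1
        · exact Sym2.congr_right.1 h1
        · exact absurd (Sym2.mem_mk_left v u) (hN' _ h1).2.1
      subst huu
      have e1 : s(v, u) ∉ N := fun h => (hN _ h).2.1 (Sym2.mem_mk_left v u)
      have e2 : s(v, u) ∉ N' := fun h => (hN' _ h).2.1 (Sym2.mem_mk_left v u)
      have : N = N' := by
        rw [← Finset.erase_insert e1, heq, Finset.erase_insert e2]
      rw [this]
    · intro M hM
      simp only [Finset.mem_filter, mem_matchings, not_forall, not_not] at hM
      obtain ⟨⟨hE, hP⟩, e, he, hve⟩ := hM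
      obtain ⟨u, rfl⟩ := hve
      have hadj : G.Adj v u := hE he
      refine ⟨⟨u, M.erase s(v, u)⟩, ?_, Finset.insert_erase he⟩
      simp only [Finset.mem_sigma, Finset.mem_erase, Finset.mem_univ, and_true,
        Finset.mem_powerset]
      refine ⟨hadj.ne', fun f hf => ?_⟩
      obtain ⟨hne, hf⟩ := Finset.mem_erase.1 hf
      have := hP he hf hne.symm
      exact Finset.mem_filter.2 ⟨mem_edgesAvoiding.2 ⟨hE hf, this v (Sym2.mem_mk_left _ _)⟩,
        this u (Sym2.mem_mk_right _ _)⟩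
    · rintro ⟨u, N⟩ h
      simp only [Finset.mem_sigma, Finset.mem_powerset] at h
      have e1 : s(v, u) ∉ N := fun h' => (hav h.2 _ h').2.1 (Sym2.mem_mk_left v u)
      rw [Finset.card_insert_of_notMem e1, pow_succ']

theorem IsOddCycleGraph.pairwise_edgesAvoiding (hG : IsOddCycleGraph G) {v : V}
    (hv : ∀ u, u ≠ v → G.Adj v u) :
    ((edgesAvoiding G v : Finset (Sym2 V)) : Set (Sym2 V)).Pairwise
      fun e f => ∀ u, u ∈ e → u ∉ f := by
  rintro e he f hf hef u ⟨a, rfl⟩ ⟨b, rfl⟩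
  rw [Finset.mem_coe, mem_edgesAvoiding] at he hf
  have hua : G.Adj u a := he.1
  have hub : G.Adj u b := hf.1
  have hav : v ≠ a := fun h => he.2 (h ▸ Sym2.mem_mk_right _ _)
  have huv : v ≠ u := fun h => he.2 (h ▸ Sym2.mem_mk_left _ _)
  have hbv : v ≠ b := fun h => hf.2 (h ▸ Sym2.mem_mk_right _ _)
  have hab : a ≠ b := fun h => hef (h ▸ rfl)
  -- If ua and ub are distinct edges avoiding `v`, then v, a, u, b is a 4-cycle.
  let c : G.Walk v v :=
    .cons (hv a hav.symm) (.cons hua.symm (.cons hub (.cons (hv b hbv.symm).symm .nil)))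
  refine hG v c ?_ (by simp [c]; decide)
  rw [SimpleGraph.Walk.isCycle_def, SimpleGraph.Walk.isTrail_def]
  simp [c, hav, huv, hbv, hab, hub.ne, hav.symm, huv.symm, hbv.symm, hua.ne']

open Classical in
theorem card_edgeSet_eq_add {v : V} (hv : ∀ u, u ≠ v → G.Adj v u) :
    G.edgeSet.ncard = (Fintype.card V - 1) + (edgesAvoiding G v).card := by
  have h1 : G.edgeSet = (((Finset.univ.erase v).image fun u => s(v, u)) ∪ edgesAvoiding G v :
      Finset (Sym2 V)) := by
    ext e
    simp only [Finset.coe_union, Set.mem_union, Finset.mem_coe, Finset.mem_image,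
      Finset.mem_erase, Finset.mem_univ, and_true, mem_edgesAvoiding]
    constructor
    · intro he
      by_cases hve : v ∈ e
      · obtain ⟨u, rfl⟩ := hve
        exact Or.inl ⟨u, (show G.Adj v u from he).ne', rfl⟩
      · exact Or.inr ⟨he, hve⟩
    · rintro (⟨u, hu, rfl⟩ | h)
      · exact hv u hu
      · exact h.1
  rw [h1, Set.ncard_coe_finset, Finset.card_union_of_disjoint, Finset.card_image_of_injective,
    Finset.card_erase_of_mem (Finset.mem_univ v), Finset.card_univ]
  · exact fun a b h => Sym2.congr_right.1 h
  · rw [Finset.disjoint_left]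
    intro e he he'
    obtain ⟨u, -, rfl⟩ := Finset.mem_image.1 he
    exact (mem_edgesAvoiding.1 he').2 (Sym2.mem_mk_left _ _)

-- Double counting: each edge avoiding `v` has two ends, both different from `v`.
open Classical in
theorem sum_card_filter_mem_edgesAvoiding (v : V) :
    ∑ u ∈ Finset.univ.erase v, ((edgesAvoiding G v).filter fun e => u ∈ e).card =
      2 * (edgesAvoiding G v).card := by
  simp only [Finset.card_filter]
  rw [Finset.sum_comm, mul_comm, ← smul_eq_mul, ← Finset.sum_const]
  refine Finset.sum_congr rfl fun e he => ?_
  obtain ⟨he, hve⟩ := mem_edgesAvoiding.1 he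
  rw [← Finset.card_filter,
    ← Sym2.card_toFinset_of_not_isDiag e (G.not_isDiag_of_mem_edgeSet he)]
  congr 1
  ext u
  simp only [Finset.mem_filter, Finset.mem_erase, Finset.mem_univ, and_true, Sym2.mem_toFinset]
  exact ⟨fun h => h.2, fun h => ⟨fun h' => hve (h' ▸ h), h⟩⟩

/-- `F(n,m)` has `k = m - (n - 1)` triangles and `p = n - 1 - 2k` pendant vertices, and these
numbers determine its matching polynomial. -/
theorem IsF.exists_eval_matchingPoly {n m : ℕ} (h : IsF G n m) :
    ∃ k p : ℕ, n = 1 + 2 * k + p ∧ m = n - 1 + k ∧ ∀ x : ℝ, x ≠ 0 →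
      (matchingPoly G).eval x = x ^ n * ((1 + -1 / x ^ 2) ^ k +
        p * (-1 / x ^ 2 * (1 + -1 / x ^ 2) ^ k) +
        2 * k * (-1 / x ^ 2 * (1 + -1 / x ^ 2) ^ (k - 1))) := by
  classical
  obtain ⟨v, hdeg⟩ := h.exists_degree
  have hcard := h.order
  have hpos : 0 < Fintype.card V := Fintype.card_pos_iff.2 ⟨v⟩
  have hv : ∀ u, u ≠ v → G.Adj v u := by
    have hsub : G.neighborSet v ⊆ ((Finset.univ.erase v : Finset V) : Set V) := by
      intro u hu
      simpa using (show G.Adj v u from hu).ne'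
    have heq := Set.eq_of_subset_of_ncard_le hsub (by
      rw [Set.ncard_coe_finset, Finset.card_erase_of_mem (Finset.mem_univ v), Finset.card_univ,
        hdeg, hcard]) (Finset.finite_toSet _)
    intro u hu
    have : u ∈ G.neighborSet v := by rw [heq]; simpa using hu
    exact this
  have hd := h.oddCycle.pairwise_edgesAvoiding hv
  have hm := card_edgeSet_eq_add hv
  have hsum := sum_card_filter_mem_edgesAvoiding (G := G) v
  set E := edgesAvoiding G v with hE
  have hle : ∀ u, (E.filter fun e => u ∈ e).card ≤ 1 := fun u => by
    rw [Finset.card_le_one]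
    intro e he f hf
    simp only [Finset.mem_filter] at he hf
    by_contra hne
    exact hd he.1 hf.1 hne u he.2 hf.2
  have hcompl : ∀ u, (E.filter fun e => u ∉ e).card = E.card - (E.filter fun e => u ∈ e).card :=
    fun u => by
      have := Finset.card_filter_add_card_filter_not (s := E) (fun e => u ∈ e)
      omega
  -- `A` collects the triangle vertices and `B` the pendant ones; removing a vertex of `A` destroys
  -- one edge of `E`, removing one of `B` none.
  set A := (Finset.univ.erase v).filter fun u => (E.filter fun e => u ∈ e).card = 1 with hA
  set B := (Finset.univ.erase v).filter fun u => ¬ (E.filter fun e => u ∈ e).card = 1 with hB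
  have hAcard : A.card = 2 * E.card := by
    rw [← hsum, hA, Finset.card_filter]
    refine Finset.sum_congr rfl fun u _ => ?_
    have := hle u
    split_ifs <;> omega
  have hABcard : A.card + B.card = Fintype.card V - 1 := by
    rw [hA, hB, Finset.card_filter_add_card_filter_not,
      Finset.card_erase_of_mem (Finset.mem_univ v), Finset.card_univ]
  refine ⟨E.card, B.card, by omega, by rw [← h.size, hm, hcard], fun x hx => ?_⟩
  rw [eval_matchingPoly_of_ne_zero hx, hcard, sum_matchings_pow_card hv hd, ← hE,
    ← Finset.sum_filter_add_sum_filter_not (Finset.univ.erase v)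
      (fun u => (E.filter fun e => u ∈ e).card = 1), ← hA, ← hB]
  have h1 : ∀ z : ℝ, ∑ u ∈ A, z * (1 + z) ^ (E.filter fun e => u ∉ e).card =
      2 * E.card * (z * (1 + z) ^ (E.card - 1)) := fun z => by
    rw [Finset.sum_congr rfl (g := fun _ => z * (1 + z) ^ (E.card - 1)), Finset.sum_const,
      hAcard, nsmul_eq_mul]
    · push_cast; ring
    · intro u hu
      rw [hcompl, (Finset.mem_filter.1 hu).2]
  have h2 : ∀ z : ℝ, ∑ u ∈ B, z * (1 + z) ^ (E.filter fun e => u ∉ e).card =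
      B.card * (z * (1 + z) ^ E.card) := fun z => by
    rw [Finset.sum_congr rfl (g := fun _ => z * (1 + z) ^ E.card), Finset.sum_const,
      nsmul_eq_mul]
    intro u hu
    have h0 := (Finset.mem_filter.1 hu).2
    have h1 := hle u
    rw [hcompl, show (E.filter fun e => u ∈ e).card = 0 by omega, Nat.sub_zero]
  rw [h1, h2]
  ring

end Counting

/-! ### The quadratic in x² and its larger root. -/

/-- The larger root of `y² - n y + p`. -/
noncomputable def largerRoot (n p : ℝ) : ℝ := (n + √(n ^ 2 - 4 * p)) / 2

theorem largerRoot_isRoot {n p : ℝ} (h : 4 * p ≤ n ^ 2) :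
    largerRoot n p ^ 2 - n * largerRoot n p + p = 0 := by
  have := Real.sq_sqrt (show 0 ≤ n ^ 2 - 4 * p by linarith)
  rw [largerRoot]
  linarith

theorem half_le_largerRoot (n p : ℝ) : n / 2 ≤ largerRoot n p := by
  have := Real.sqrt_nonneg (n ^ 2 - 4 * p)
  rw [largerRoot]
  linarith

theorem le_largerRoot {n p y : ℝ} (h : y ^ 2 - n * y + p ≤ 0) : y ≤ largerRoot n p := by
  have : 2 * y - n ≤ √(n ^ 2 - 4 * p) := Real.le_sqrt_of_sq_le (by nlinarith)
  rw [largerRoot]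
  linarith

theorem lt_largerRoot {n p y : ℝ} (h : y ^ 2 - n * y + p < 0) : y < largerRoot n p := by
  have : 2 * y - n < √(n ^ 2 - 4 * p) := Real.lt_sqrt_of_sq_lt (by nlinarith)
  rw [largerRoot]
  linarith

section Root

variable {V : Type*} [Fintype V] {G : SimpleGraph V}

theorem IsF.isGreatest_sqrt {n m : ℕ} (h : IsF G n m) (hn : 2 ≤ n) :
    4 * (3 * (n : ℝ) - 3 - 2 * m) ≤ (n : ℝ) ^ 2 ∧
    IsGreatest (matchingRoots G) √(largerRoot n (3 * n - 3 - 2 * m)) := by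
  obtain ⟨k, p, hnk, hmk, hev⟩ := h.exists_eval_matchingPoly
  have hmk' : m = 3 * k + p := by omega
  have hN : (n : ℝ) = 1 + 2 * k + p := by exact_mod_cast hnk
  have hp : (3 * (n : ℝ) - 3 - 2 * m) = p := by
    rw [hN, hmk']; push_cast; ring
  rw [hp]
  have hn' : (2 : ℝ) ≤ n := by exact_mod_cast hn
  have hk0 : (0 : ℝ) ≤ k := Nat.cast_nonneg k
  have hp0 : (0 : ℝ) ≤ p := Nat.cast_nonneg p
  have hdisc : 4 * (p : ℝ) ≤ (n : ℝ) ^ 2 := by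
    -- Here n ≥ 1 + p, and (1 + p)² - 4p = (p - 1)².
    rw [hN]; nlinarith [sq_nonneg ((p : ℝ) - 1)]
  refine ⟨hdisc, ?_⟩
  have hroot := largerRoot_isRoot hdisc
  have hhalf := half_le_largerRoot n p
  have hle : ∀ y : ℝ, y ^ 2 - n * y + p ≤ 0 → y ≤ largerRoot n p := fun _ => le_largerRoot
  set t := largerRoot n p with ht
  have ht1 : 1 ≤ t := by linarith
  have hs2 : √t ^ 2 = t := Real.sq_sqrt (by linarith)
  have hspos : 0 < √t := Real.sqrt_pos.2 (by linarith)
  -- A star has no factor (1+z)^(k-1) to split off: its nonzero roots satisfy x² = p, while the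
  -- quadratic is (y - 1)(y - p) with p ≥ 1.
  rcases Nat.eq_zero_or_pos k with rfl | hk
  · have hNp : (n : ℝ) = 1 + p := by rw [hN]; simp
    have htp : t = p := by
      have h2 : (t - 1) * (t - p) = 0 := by rw [hNp] at hroot; linarith
      rcases mul_eq_zero.1 h2 with h3 | h3 <;> linarith
    have hev' : ∀ x : ℝ, x ≠ 0 → ((matchingPoly G).eval x = 0 ↔ x ^ 2 = p) := fun x hx => by
      rw [hev x hx, mul_eq_zero, or_iff_right (pow_ne_zero _ hx)]
      simp only [pow_zero, Nat.cast_zero, mul_zero, zero_mul, add_zero, mul_one]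
      field_simp
      constructor <;> intro h <;> linarith
    refine ⟨(hev' _ hspos.ne').2 (by rw [hs2, htp]), fun x hx => ?_⟩
    by_cases hx0 : x = 0
    · rw [hx0]; exact hspos.le
    · exact Real.le_sqrt_of_sq_le (((hev' x hx0).1 hx).trans htp.symm).le
  · obtain ⟨j, rfl⟩ : ∃ j, k = j + 1 := ⟨k - 1, by omega⟩
    have hev' : ∀ x : ℝ, x ≠ 0 → ((matchingPoly G).eval x = 0 ↔
        ((1 + -1 / x ^ 2) ^ j = 0 ∨ (x ^ 2) ^ 2 - n * x ^ 2 + p = 0)) := fun x hx => by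
      have hfac : (x ^ 2) ^ 2 * (matchingPoly G).eval x = x ^ n * ((1 + -1 / x ^ 2) ^ j *
          ((x ^ 2) ^ 2 - n * x ^ 2 + p)) := by
        rw [hev x hx, Nat.add_sub_cancel, hN, pow_succ (1 + -1 / x ^ 2) j]
        have hz : x ^ 2 * (-1 / x ^ 2) = -1 := by field_simp
        generalize -1 / x ^ 2 = z at hz ⊢
        generalize (1 + z) ^ j = w
        push_cast
        linear_combination x ^ n * w *
          ((1 + p + 2 * (j + 1)) * x ^ 2 + p * (x ^ 2 * z - 1)) * hz
      rw [← mul_eq_zero, ← mul_eq_zero_iff_left (pow_ne_zero 2 (pow_ne_zero 2 hx)), hfac,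
        mul_eq_zero_iff_left (pow_ne_zero _ hx)]
    refine ⟨(hev' _ hspos.ne').2 (Or.inr (by rw [hs2]; exact hroot)), fun x hx => ?_⟩
    by_cases hx0 : x = 0
    · rw [hx0]; exact hspos.le
    · refine Real.le_sqrt_of_sq_le ?_
      -- Roots of the factor (1+z)^j have x² = 1, which is at most n/2 ≤ `t`.
      rcases (hev' x hx0).1 hx with h1 | h1
      · have h2 := eq_zero_of_pow_eq_zero h1
        have : x ^ 2 = 1 := by
          field_simp at h2
          linarith
        linarith
      · exact hle _ h1.le

theorem IsF.maxMatchingRoot_eq {n m : ℕ} (h : IsF G n m) (hn : 2 ≤ n) :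
    maxMatchingRoot G = √(largerRoot n (3 * n - 3 - 2 * m)) :=
  (h.isGreatest_sqrt hn).2.csSup_eq

theorem IsF.isGreatest_maxMatchingRoot {n m : ℕ} (h : IsF G n m) :
    IsGreatest (matchingRoots G) (maxMatchingRoot G) := by
  suffices ∃ a, IsGreatest (matchingRoots G) a by
    obtain ⟨a, ha⟩ := this
    rw [maxMatchingRoot, ha.csSup_eq]
    exact ha
  by_cases hn : 2 ≤ n
  · exact ⟨_, (h.isGreatest_sqrt hn).2⟩
  -- For a single vertex the polynomial is x, whose only root is 0.
  · obtain ⟨k, p, hnk, hmk, hev⟩ := h.exists_eval_matchingPoly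
    obtain rfl : k = 0 := by omega
    obtain rfl : p = 0 := by omega
    obtain rfl : n = 1 := by omega
    refine ⟨0, ?_, fun x hx => ?_⟩
    · simp [matchingRoots, matchingPoly, h.order]
    · by_contra hlt
      have hx0 : x ≠ 0 := fun h => hlt h.le
      have : (matchingPoly G).eval x = 0 := hx
      rw [hev x hx0] at this
      simp [hx0] at this

theorem IsF.maxMatchingRoot_lt_of_size {W : Type*} [Fintype W] {H : SimpleGraph W} {n m : ℕ}
    (hG : IsF G n m) (hH : IsF H n (m + 1)) (hn : 2 ≤ n) :
    maxMatchingRoot G < maxMatchingRoot H := by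
  rw [hG.maxMatchingRoot_eq hn, hH.maxMatchingRoot_eq hn]
  have h1 := largerRoot_isRoot (hG.isGreatest_sqrt hn).1
  have h0 := half_le_largerRoot n (3 * (n : ℝ) - 3 - 2 * m)
  have hn' : (2 : ℝ) ≤ n := by exact_mod_cast hn
  refine Real.sqrt_lt_sqrt (by linarith) (lt_largerRoot ?_)
  push_cast
  linarith

theorem IsF.maxMatchingRoot_lt_of_order {W : Type*} [Fintype W] {H : SimpleGraph W} {n m : ℕ}
    (hG : IsF G n m) (hH : IsF H (n + 1) m) (hn : 2 ≤ n) (hm : 4 ≤ m) :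
    maxMatchingRoot G < maxMatchingRoot H := by
  rw [hG.maxMatchingRoot_eq hn, hH.maxMatchingRoot_eq (by omega)]
  have h1 := largerRoot_isRoot (hG.isGreatest_sqrt hn).1
  have hm' : (4 : ℝ) ≤ m := by exact_mod_cast hm
  -- At 3 the quadratic equals 6 - 2m; at the old root the new quadratic exceeds the old one by 3 -
  -- y.
  have h3 : 3 < largerRoot n (3 * (n : ℝ) - 3 - 2 * m) := lt_largerRoot (by linarith)
  refine Real.sqrt_lt_sqrt (by linarith) (lt_largerRoot ?_)
  push_cast
  linarith

end Root

/-! ### Existence of F(n,m). -/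

section Existence

/-- A graph in which every vertex other than `v` has at most one neighbour other than `v` has no
even cycle. -/
theorem isOddCycleGraph_of_unique {V : Type*} {G : SimpleGraph V} (v : V)
    (h : ∀ a b c, a ≠ v → b ≠ v → c ≠ v → G.Adj b a → G.Adj b c → a = c) :
    IsOddCycleGraph G := by
  classical
  -- If only the base point may be `v`, the vertices at positions 1 and 3 are both neighbours of the
  -- one at position 2, so they coincide, which a cycle of length at least 4 forbids.
  have key : ∀ (u : V) (c : G.Walk u u), c.IsCycle → 4 ≤ c.length →
      (∀ i, 0 < i → i < c.length → c.getVert i ≠ v) → False := by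
    intro u c hc h4 hv
    have h12 := c.adj_getVert_succ (i := 1) (by omega)
    have h23 := c.adj_getVert_succ (i := 2) (by omega)
    have heq := h _ _ _ (hv 1 (by omega) (by omega)) (hv 2 (by omega) (by omega))
      (hv 3 (by omega) (by omega)) h12.symm h23
    have := hc.getVert_injOn (by simp; omega) (by simp; omega) heq
    omega
  intro u c hc heven
  have h4 : 4 ≤ c.length := by
    have := hc.three_le_length
    rcases heven with ⟨j, hj⟩
    omega
  by_cases hmem : v ∈ c.support
  -- Rotating the cycle to start at `v` leaves `v` at no interior position.
  · refine key v (c.rotate v hmem) (hc.rotate hmem) (by simpa using h4) fun i h0 hi heq => ?_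
    have := (hc.rotate hmem).getVert_injOn (x₁ := i) (x₂ := (c.rotate v hmem).length)
      (by simp at hi ⊢; omega) (by simp; omega) (by rw [heq, SimpleGraph.Walk.getVert_length])
    omega
  · exact key u c hc h4 fun i _ _ heq => hmem (heq ▸ c.getVert_mem_support i)

/-- `k` triangles with a common vertex `0`, and pendant edges joining `0` to the remaining
vertices. -/
def friendshipGraph (n k : ℕ) : SimpleGraph (Fin (n + 1)) :=
  SimpleGraph.fromRel fun a b =>
    a.val = 0 ∨ ∃ i < k, a.val = 2 * i + 1 ∧ b.val = 2 * i + 2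

theorem isF_friendshipGraph {n k : ℕ} (h : 2 * k ≤ n) :
    IsF (friendshipGraph n k) (n + 1) (n + k) := by
  classical
  have hv : ∀ u : Fin (n + 1), u ≠ 0 → (friendshipGraph n k).Adj 0 u := fun u hu => by
    simp [friendshipGraph, hu.symm]
  refine ⟨by simp, ?_, ?_, 0, ?_⟩
  · rw [card_edgeSet_eq_add hv, Fintype.card_fin, Nat.add_sub_cancel]
    congr 1
    have : edgesAvoiding (friendshipGraph n k) 0 = (Finset.univ : Finset (Fin k)).image
        fun i : Fin k =>
          s((⟨2 * i.val + 1, by omega⟩ : Fin (n + 1)), ⟨2 * i.val + 2, by omega⟩) := by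
      ext e
      induction e with | _ a b
      simp only [mem_edgesAvoiding, friendshipGraph, SimpleGraph.mem_edgeSet,
        SimpleGraph.fromRel_adj, Sym2.mem_iff, Finset.mem_image, Finset.mem_univ, true_and,
        Sym2.eq_iff, Fin.ext_iff, Fin.val_zero, ne_eq]
      constructor
      · rintro ⟨⟨hab, (h0 | ⟨i, hi, h1, h2⟩) | (h0 | ⟨i, hi, h1, h2⟩)⟩, hne⟩
        · omega
        · exact ⟨⟨i, hi⟩, Or.inl ⟨h1.symm, h2.symm⟩⟩
        · omega
        · exact ⟨⟨i, hi⟩, Or.inr ⟨h1.symm, h2.symm⟩⟩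
      · rintro ⟨⟨i, hi⟩, ⟨h1, h2⟩ | ⟨h1, h2⟩⟩ <;> dsimp only at h1 h2
        · exact ⟨⟨by omega, Or.inl (Or.inr ⟨i, hi, h1.symm, h2.symm⟩)⟩, by omega⟩
        · exact ⟨⟨by omega, Or.inr (Or.inr ⟨i, hi, h1.symm, h2.symm⟩)⟩, by omega⟩
    rw [this, Finset.card_image_of_injective, Finset.card_univ, Fintype.card_fin]
    intro i j hij
    simp only [Sym2.eq_iff, Fin.ext_iff] at hij
    ext
    omega
  · refine isOddCycleGraph_of_unique 0 fun a b c ha hb hc hba hbc => ?_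
    simp only [friendshipGraph, SimpleGraph.fromRel_adj, Fin.ext_iff, Fin.val_zero, ne_eq]
      at ha hb hc hba hbc ⊢
    obtain ⟨-, (h1 | ⟨i, -, h1, h2⟩) | (h1 | ⟨i, -, h1, h2⟩)⟩ := hba <;>
    obtain ⟨-, (h3 | ⟨j, -, h3, h4⟩) | (h3 | ⟨j, -, h3, h4⟩)⟩ := hbc <;> omega
  · have : (friendshipGraph n k).neighborSet 0 =
        ((Finset.univ.erase 0 : Finset (Fin (n + 1))) : Set (Fin (n + 1))) := by
      ext u
      simp only [SimpleGraph.mem_neighborSet, Finset.coe_erase, Finset.coe_univ, Set.mem_sdiff,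
        Set.mem_univ, true_and, Set.mem_singleton_iff]
      exact ⟨fun h => h.ne', hv u⟩
    rw [this, Set.ncard_coe_finset, Finset.card_erase_of_mem (Finset.mem_univ _),
      Finset.card_univ, Fintype.card_fin]

theorem exists_isF {n m : ℕ} (hn : 1 ≤ n) (h1 : n - 1 ≤ m) (h2 : m ≤ 3 * (n - 1) / 2) :
    ∃ G : SimpleGraph (Fin n), IsF G n m := by
  obtain ⟨n, rfl⟩ : ∃ j, n = j + 1 := ⟨n - 1, by omega⟩
  obtain ⟨k, rfl⟩ := Nat.exists_eq_add_of_le h1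
  exact ⟨friendshipGraph n k, isF_friendshipGraph (by omega)⟩

end Existence

end OddCycleGraphs

theorem theorem4p1 :
    -- `F(n,m)` exists for `n - 1 ≤ m ≤ ⌊3(n-1)/2⌋`
    (∀ n m : ℕ, 1 ≤ n → n - 1 ≤ m → m ≤ 3 * (n - 1) / 2 →
      ∃ G : SimpleGraph (Fin n), IsF G n m) ∧
    -- `t(F(n,m))` is attained as a largest matching root
    (∀ (n m : ℕ) (V : Type*) [Fintype V] (G : SimpleGraph V), IsF G n m →
      IsGreatest (matchingRoots G) (maxMatchingRoot G)) ∧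
    -- `t(F(n,m)) < t(F(n,m+1))` for `n - 1 ≤ m ≤ ⌊3(n-1)/2⌋ - 1`
    (∀ n m : ℕ, 1 ≤ n → n - 1 ≤ m → m + 1 ≤ 3 * (n - 1) / 2 →
      ∀ (V W : Type*) [Fintype V] [Fintype W] (G : SimpleGraph V) (H : SimpleGraph W),
        IsF G n m → IsF H n (m + 1) → maxMatchingRoot G < maxMatchingRoot H) ∧
    -- `t(F(n,m)) < t(F(n+1,m))` for `m ≥ 4` and `⌈(2m+1)/3⌉ ≤ n ≤ m`
    (∀ n m : ℕ, 4 ≤ m → ⌈(2 * (m : ℚ) + 1) / 3⌉₊ ≤ n → n ≤ m →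
      ∀ (V W : Type*) [Fintype V] [Fintype W] (G : SimpleGraph V) (H : SimpleGraph W),
        IsF G n m → IsF H (n + 1) m → maxMatchingRoot G < maxMatchingRoot H) := by
  refine ⟨fun n m hn h1 h2 => exists_isF hn h1 h2,
    fun n m V _ G hG => hG.isGreatest_maxMatchingRoot,
    fun n m hn h1 h2 V W _ _ G H hG hH => hG.maxMatchingRoot_lt_of_size hH (by omega),
    fun n m hm h1 h2 V W _ _ G H hG hH => hG.maxMatchingRoot_lt_of_order hH ?_ hm⟩
  have h3 : (2 * (m : ℚ) + 1) / 3 ≤ n := Nat.ceil_le.1 h1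
  have h4 : (4 : ℚ) ≤ m := by exact_mod_cast hm
  have h5 : (2 : ℚ) ≤ n := by linarith
  exact_mod_cast h5
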